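/- Let $N,M\ge 0$ be integers, let $f\in C^1(\mathbb{R}^N,\mathbb{R}^N)$, $g\in C^1(\mathbb{R}^N,\mathbb{R}^{N\times M})$, $h\in C^1(\mathbb{R}^N,\mathbb{R})$, and let $R\in\mathbb{R}^{M\times M}$ be symmetric positive definite. Assume that $f(0)=0$, $h(0)=0$ and $h(x)>0$ for all $x\neq 0$. For $x\in\mathbb{R}^N$ and $\mathbf{u}\in\mathcal{U}_\infty:=L^\infty([0,\infty);\mathbb{R}^M)$ let $\mathbf{x}_{\mathbf{u}}(\cdot;x)$ be the maximal Carathéodory solution of $$\dot{\mathbf{x}}(t)=f(\mathbf{x}(t))+g(\mathbf{x}(t))\mathbf{u}(t),\qquad \mathbf{x}(0)=x,$$ and put $$J_\infty(x,\mathbf{u}):=\int_0^\infty h(\mathbf{x}_{\mathbf{u}}(t;x))+\langle \mathbf{u}(t),R\,\mathbf{u}(t)\rangle\,dt\in[0,\infty],$$ with $J_\infty(x,\mathbf{u})=+\infty$ if the trajectory blows up in finite time. The optimal value function is $v^*(x):=\inf_{\mathbf{u}\in\mathcal{U}_\infty}J_\infty(x,\mathbf{u})\in[0,\infty]$. Let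 $\Omega\subset\mathbb{R}^N$ be a domain (nonempty, open, connected) containing the origin, suppose that $v^*\in C^1(\Omega,\mathbb{R})$ (in particular $v^*$ is finite on $\Omega$), and let $\alpha,\beta>0$. Then there is an open neighborhood $\tilde\Omega\subset\Omega$ of the origin, depending only on $\Omega$, $\alpha$, $\beta$ and $v^*$, such that every $v\in C^1(\Omega,\mathbb{R})$ satisfying 1. $v(x)\ge 0$ for all $x\in\Omega$ and $v(0)=0$; 2. $\langle f(x)+g(x)u_v(x),\nabla v(x)\rangle+h(x)+\langle u_v(x),R\,u_v(x)\rangle=0$ for all $x\in\Omega$, where $u_v(x):=-\tfrac12 R^{-1}g(x)^{\top}\nabla v(x)$; 3. $\alpha\|x\|^2\le v(x)\le\beta\|x\|^2$ for all $x\in\Omega$ satisfies $$v(x)=v^*(x)\qquad\text{for all }x\in\tilde\Omega .$$ In particular, $\tilde\Omega$ is independent of the particular candidate $v$. -/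

import Mathlib

open MeasureTheory Set
open scoped ENNReal

noncomputable section

/-- The Euclidean space `ℝⁿ` with its Euclidean inner product and norm. -/
abbrev Euc (n : ℕ) : Type := EuclideanSpace ℝ (Fin n)

/-- The matrix-vector product `A x`, as a map between Euclidean spaces. -/
def mulEuc {m n : ℕ} (A : Matrix (Fin m) (Fin n) ℝ) (x : Euc n) : Euc m :=
  WithLp.toLp 2 (A.mulVec x.ofLp)

/-- The quadratic form `⟨x, A x⟩`, i.e. the square of the weighted norm `‖x‖_A` when `A` is
symmetric positive definite. -/
def quadForm {n : ℕ} (A : Matrix (Fin n) (Fin n) ℝ) (x : Euc n) : ℝ :=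
  inner ℝ x (mulEuc A x)

/-- The data of a control-affine infinite-horizon optimal control problem with state space `ℝᴺ`
and control space `ℝᴹ`: dynamics `x' = f(x) + g(x) u`, running cost `h(x) + ⟨u, R u⟩`. -/
structure ControlProblem (N M : ℕ) where
  f : Euc N → Euc N
  g : Euc N → Matrix (Fin N) (Fin M) ℝ
  h : Euc N → ℝ
  R : Matrix (Fin M) (Fin M) ℝ

namespace ControlProblem

variable {N M : ℕ}

/-- The standing assumptions on the data. -/
structure Admissible (P : ControlProblem N M) : Prop where
  contDiff_f : ContDiff ℝ 1 P.f
  contDiff_g : ∀ i j, ContDiff ℝ 1 (fun x => P.g x i j)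
  contDiff_h : ContDiff ℝ 1 P.h
  symm_R : P.R.transpose = P.R
  pos_R : ∀ u : Euc M, u ≠ 0 → 0 < quadForm P.R u
  f_zero : P.f 0 = 0
  h_zero : P.h 0 = 0
  h_pos : ∀ x : Euc N, x ≠ 0 → 0 < P.h x

/-- The input set `L^∞([0,∞); ℝᴹ)`; only the values of `u` on `[0,∞)` matter. -/
def IsInput (u : ℝ → Euc M) : Prop :=
  MemLp u ∞ (volume.restrict (Ici (0 : ℝ)))

/-- `X` is a Carathéodory solution on all of `[0,∞)` of `X' = f(X) + g(X) u`, `X(0) = x`, written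
as the integral equation. For an input `u` and a continuous `X` the integrand is bounded and
measurable on every `[0,t]`, hence integrable. -/
structure IsTrajectory (P : ControlProblem N M) (x : Euc N) (u : ℝ → Euc M)
    (X : ℝ → Euc N) : Prop where
  continuousOn : ContinuousOn X (Ici (0 : ℝ))
  integral_eq : ∀ t : ℝ, 0 ≤ t →
    X t = x + ∫ s in (0 : ℝ)..t, (P.f (X s) + mulEuc (P.g (X s)) (u s))

/-- The cost `∫₀^∞ h(X(t)) + ⟨u(t), R u(t)⟩ dt ∈ [0,∞]` of a state-input pair (the integrand is
nonnegative under the standing assumptions). -/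
def cost (P : ControlProblem N M) (u : ℝ → Euc M) (X : ℝ → Euc N) : ℝ≥0∞ :=
  ∫⁻ t in Ici (0 : ℝ), ENNReal.ofReal (P.h (X t) + quadForm P.R (u t))

/-- The objective functional `J_∞(x,u)`. Under the standing assumptions the trajectory generated
by an input `u` is unique on `[0,∞)` if it exists, so the infimum is just its cost; it is `∞` if
the trajectory blows up in finite time, for then there is no trajectory on `[0,∞)`. -/
def objective (P : ControlProblem N M) (x : Euc N) (u : ℝ → Euc M) : ℝ≥0∞ :=
  ⨅ (X : ℝ → Euc N) (_ : P.IsTrajectory x u X), P.cost u X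

/-- The optimal value function `v^*(x) = inf_u J_∞(x,u)`, with values in `[0,∞]`. -/
def optimalValue (P : ControlProblem N M) (x : Euc N) : ℝ≥0∞ :=
  ⨅ (u : ℝ → Euc M) (_ : IsInput u), P.objective x u

/-- `w : ℝᴺ → [0,∞]` belongs to `C¹(Ω, ℝ)` (`Ω` open): it is finite on `Ω` and continuously
differentiable there. -/
def IsRealC1On (w : Euc N → ℝ≥0∞) (Ω : Set (Euc N)) : Prop :=
  (∀ x ∈ Ω, w x ≠ ∞) ∧ ContDiffOn ℝ 1 (fun x => (w x).toReal) Ω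

/-- The feedback `u_v(x) = -½ R⁻¹ g(x)ᵀ ∇v(x)`. -/
def feedback (P : ControlProblem N M) (v : Euc N → ℝ) (x : Euc N) : Euc M :=
  (-(1 / 2) : ℝ) • mulEuc (P.R⁻¹ * (P.g x).transpose) (gradient v x)

/-- The Hamilton-Jacobi-Bellman identity for `v` on `Ω`. -/
def SolvesHJB (P : ControlProblem N M) (v : Euc N → ℝ) (Ω : Set (Euc N)) : Prop :=
  ∀ x ∈ Ω,
    inner ℝ (P.f x + mulEuc (P.g x) (P.feedback v x)) (gradient v x)
      + P.h x + quadForm P.R (P.feedback v x) = 0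

end ControlProblem

end

/-! Fix a closed ball of radius `r` around the origin inside `Ω`, and let `m` be a positive lower
bound of `vstar` on its sphere. Both inequalities hold where `‖x‖ < r`, `vstar x < m` and `β‖x‖² <
αr²`, and these conditions do not involve `v`.

Upper bound (`SolvesHJB.optimalValue_le`): along the closed loop, the Hamilton-Jacobi-Bellman
identity makes `v` decrease at exactly the rate of the running cost. Hence `α‖X‖² ≤ v(X) ≤ v(x) ≤
β‖x‖² < αr²`, the trajectory never leaves the ball, and its cost is at most `v(x)`. The feedback is
merely continuous, so the closed loop is solved by Peano's theorem.

Lower bound (`SolvesHJB.le_optimalValue`): completing the square shows that `v` decreases along any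
trajectory at most by the accumulated cost. A trajectory of cost below `m` cannot reach the sphere,
since its remaining cost from there would be at least `m`. As its cost is finite and `h` is positive
off the origin, it comes arbitrarily close to the origin, where `v ≤ β‖·‖²` is negligible.

That `m` is positive rests on `Admissible.optimalValue_pos`: away from the origin the running cost
controls the speed, so moving a fixed distance has a price. -/

open Filter Topology Metric
open scoped NNReal

/-! ### Existence of solutions: Picard-Lindelöf, Arzelà-Ascoli, Peano -/

/-- Global solutions in integral form of autonomous equations with a bounded `C¹` right-hand
side, on a compact time interval; the solution is extended to a Lipschitz function on `ℝ`. -/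
theorem ODE.exists_lipschitzWith_eq_add_integral_of_contDiff {E : Type*} [NormedAddCommGroup E]
    [NormedSpace ℝ E] [FiniteDimensional ℝ E] {G : E → E} (hG : ContDiff ℝ 1 G) {L : ℝ≥0}
    (hL : ∀ y, ‖G y‖ ≤ L) (x : E) {T : ℝ} (hT : 0 ≤ T) :
    ∃ X : ℝ → E, LipschitzWith L X ∧ X 0 = x ∧
      ∀ t ∈ Icc 0 T, X t = x + ∫ s in (0 : ℝ)..t, G (X s) := by
  -- A curve of speed at most `L` travels at most `L * T`, so one Picard-Lindelöf step on this ball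
  -- covers all of `[0,T]`.
  set a : ℝ≥0 := L * ⟨T, hT⟩ with ha
  obtain ⟨K, hK⟩ := hG.contDiffOn.exists_lipschitzOnWith (by decide)
    (convex_closedBall x (a : ℝ)) (isCompact_closedBall x (a : ℝ))
  have hPL : IsPicardLindelof (fun _ : ℝ => G) (tmin := 0) (tmax := T) ⟨0, by simp [hT]⟩ x a 0 L K :=
    .of_time_independent (fun y _ => hL y) hK (by
      simp only [sub_zero, sub_self, max_eq_left hT, NNReal.coe_zero]
      exact (NNReal.coe_mul L ⟨T, hT⟩).ge)
  obtain ⟨Y, hY0, hY⟩ := hPL.exists_eq_forall_mem_Icc_hasDerivWithinAt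
    (x := x) (by simp)
  have hYL : LipschitzOnWith L Y (Icc 0 T) :=
    (convex_Icc 0 T).lipschitzOnWith_of_nnnorm_hasDerivWithin_le hY (fun t _ => hL (Y t))
  have hYc : ContinuousOn Y (Icc 0 T) := hYL.continuousOn
  refine ⟨fun t => Y (projIcc 0 T hT t), ?_, ?_, ?_⟩
  · have := hYL.to_restrict.comp (LipschitzWith.projIcc hT)
    simpa using! this
  · simpa [projIcc_of_mem hT (left_mem_Icc.2 hT)] using hY0
  · intro t ht
    have hsub : Icc 0 t ⊆ Icc 0 T := Icc_subset_Icc_right ht.2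
    have hGY : ContinuousOn (fun s => G (Y s)) (Icc 0 t) :=
      hG.continuous.comp_continuousOn (hYc.mono hsub)
    have h1 : ∫ s in (0 : ℝ)..t, G (Y s) = Y t - Y 0 := by
      refine intervalIntegral.integral_eq_sub_of_hasDerivAt_of_le ht.1 (hYc.mono hsub) ?_
        (hGY.intervalIntegrable_of_Icc ht.1)
      intro s hs
      exact (hY s ⟨hs.1.le, hs.2.le.trans ht.2⟩).hasDerivAt
        (Icc_mem_nhds hs.1 (hs.2.trans_le ht.2))
    have h2 : ∫ s in (0 : ℝ)..t, G (Y (projIcc 0 T hT s)) = ∫ s in (0 : ℝ)..t, G (Y s) := by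
      refine intervalIntegral.integral_congr fun s hs => ?_
      rw [uIcc_of_le ht.1] at hs
      simp only [projIcc_of_mem hT (hsub hs)]
    change Y (projIcc 0 T hT t) = _
    rw [h2, h1, projIcc_of_mem hT ht, show Y 0 = x from hY0]
    abel

/-- The `K`-Lipschitz curves through a given point of a proper space form a compact set. -/
theorem ContinuousMap.isCompact_setOf_lipschitzWith {E : Type*} [MetricSpace E] [ProperSpace E]
    (K : ℝ≥0) (x : E) : IsCompact {X : C(ℝ, E) | LipschitzWith K X ∧ X 0 = x} := by
  refine ArzelaAscoli.isCompact_of_equicontinuous _ ?_ ?_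
  · have himg : ContinuousMap.toFun '' {X : C(ℝ, E) | LipschitzWith K X ∧ X 0 = x}
        = {φ : ℝ → E | LipschitzWith K φ ∧ φ 0 = x} := by
      ext φ
      constructor
      · rintro ⟨X, hX, rfl⟩
        exact hX
      · intro hφ
        exact ⟨⟨φ, hφ.1.continuous⟩, hφ, rfl⟩
    rw [himg]
    have hcpt : IsCompact (Set.pi univ fun t : ℝ => closedBall x (K * dist t 0)) :=
      isCompact_univ_pi fun t => isCompact_closedBall _ _
    refine hcpt.of_isClosed_subset ?_ ?_
    · have : {φ : ℝ → E | LipschitzWith K φ ∧ φ 0 = x}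
          = (⋂ (s : ℝ) (t : ℝ), {φ : ℝ → E | dist (φ s) (φ t) ≤ K * dist s t})
            ∩ {φ | φ 0 = x} := by
        ext φ
        simp [lipschitzWith_iff_dist_le_mul]
      rw [this]
      refine IsClosed.inter ?_ (isClosed_eq (continuous_apply _) continuous_const)
      refine isClosed_iInter fun s => isClosed_iInter fun t => ?_
      exact isClosed_le ((continuous_apply s).dist (continuous_apply t)) continuous_const
    · rintro φ ⟨hφ, h0⟩ t -
      rw [mem_closedBall, ← h0]
      exact hφ.dist_le_mul t 0
  · refine Metric.equicontinuous_of_continuity_modulus (fun d => K * d) ?_ _ ?_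
    · simpa using (tendsto_id (x := 𝓝 (0 : ℝ))).const_mul (K : ℝ)
    · rintro s t ⟨X, hX⟩
      exact hX.1.dist_le_mul s t

/-- **Peano's theorem**, global version for a bounded continuous right-hand side. -/
theorem ODE.exists_eq_add_integral_of_continuous {E : Type*} [NormedAddCommGroup E]
    [NormedSpace ℝ E] [FiniteDimensional ℝ E] {G : E → E} (hG : Continuous G) {L : ℝ}
    (hL : ∀ y, ‖G y‖ ≤ L) (x : E) :
    ∃ X : ℝ → E, Continuous X ∧ ∀ t, 0 ≤ t → X t = x + ∫ s in (0 : ℝ)..t, G (X s) := by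
  have hL0 : 0 ≤ L := (norm_nonneg _).trans (hL x)
  -- The smooth approximations of `G` lie within distance 1 of it, so `L + 1` bounds them all and is
  -- a common Lipschitz constant of the approximate solutions.
  set K : ℝ≥0 := ⟨L + 1, by positivity⟩ with hKdef
  have hδ (n : ℕ) : (0 : ℝ) < 1 / ((n : ℝ) + 1) := Nat.one_div_pos_of_nat
  have hstep (n : ℕ) : ∃ (H : E → E) (X : C(ℝ, E)), Continuous H ∧
      (∀ y, dist (H y) (G y) < 1 / ((n : ℝ) + 1)) ∧ (LipschitzWith K X ∧ X 0 = x) ∧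
      ∀ t ∈ Icc (0 : ℝ) n, X t = x + ∫ s in (0 : ℝ)..t, H (X s) := by
    obtain ⟨H, hH, hHG, -⟩ := hG.exists_contDiff_approx 1 (ε := fun _ => 1 / ((n : ℝ) + 1))
      continuous_const (fun _ => hδ n)
    have hHb : ∀ y, ‖H y‖ ≤ K := by
      intro y
      have h1 : ‖H y - G y‖ ≤ 1 := by
        rw [← dist_eq_norm]
        refine (hHG y).le.trans ?_
        rw [div_le_one (by positivity)]
        linarith [(Nat.cast_nonneg n : (0 : ℝ) ≤ n)]
      have h2 : ‖H y‖ ≤ ‖H y - G y‖ + ‖G y‖ := by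
        simpa using norm_add_le (H y - G y) (G y)
      have := hL y
      change ‖H y‖ ≤ L + 1
      linarith
    obtain ⟨X, hXL, hX0, hX⟩ := ODE.exists_lipschitzWith_eq_add_integral_of_contDiff
      (by exact_mod_cast hH) hHb x (Nat.cast_nonneg n)
    exact ⟨H, ⟨X, hXL.continuous⟩, hH.continuous, hHG, ⟨hXL, hX0⟩, hX⟩
  choose H X hHc hHG hXS hX using hstep
  -- A limit along an ultrafilter replaces the extraction of a convergent subsequence.
  have hUle : (hyperfilter ℕ : Filter ℕ) ≤ atTop := Nat.hyperfilter_le_atTop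
  obtain ⟨Y, -, hY⟩ := (ContinuousMap.isCompact_setOf_lipschitzWith K x).ultrafilter_le_nhds
    ((hyperfilter ℕ).map X) (by
      rw [le_principal_iff]
      exact Filter.univ_mem' (f := (hyperfilter ℕ : Filter ℕ)) hXS)
  have hXY : Tendsto X (hyperfilter ℕ : Filter ℕ) (𝓝 Y) := hY
  refine ⟨Y, Y.continuous, fun t ht => ?_⟩
  have hpt : Tendsto (fun n => X n t) (hyperfilter ℕ : Filter ℕ) (𝓝 (Y t)) :=
    ((continuous_eval_const (F := C(ℝ, E)) t).tendsto Y).comp hXY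
  have hGX : TendstoUniformlyOn (fun n s => G (X n s)) (fun s => G (Y s))
      (hyperfilter ℕ : Filter ℕ) (Icc 0 t) := by
    have h := ((ContinuousMap.continuous_postcomp (X := ℝ) ⟨G, hG⟩).tendsto Y).comp hXY
    exact ContinuousMap.tendsto_iff_forall_isCompact_tendstoUniformlyOn.1 h _ isCompact_Icc
  refine tendsto_nhds_unique hpt ?_
  rw [Metric.tendsto_nhds]
  intro ε hε
  -- Two errors of this size, from `H` to `G` and from `X n` to `Y`, integrate over `[0,t]` to at
  -- most `ε * t / (t + 1) < ε`.
  have hη : 0 < ε / (2 * (t + 1)) := by positivity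
  have h1 := Metric.tendstoUniformlyOn_iff.1 hGX _ hη
  have h2 : ∀ᶠ n : ℕ in (hyperfilter ℕ : Filter ℕ), 1 / ((n : ℝ) + 1) < ε / (2 * (t + 1)) :=
    hUle ((tendsto_order.1 tendsto_one_div_add_atTop_nhds_zero_nat).2 _ hη)
  have h3 : ∀ᶠ n : ℕ in (hyperfilter ℕ : Filter ℕ), t ≤ n :=
    hUle (tendsto_natCast_atTop_atTop.eventually_ge_atTop t)
  filter_upwards [h1, h2, h3] with n hn1 hn2 hn3
  rw [hX n t ⟨ht, hn3⟩, dist_add_left, dist_eq_norm, ← intervalIntegral.integral_sub]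
  · have hb : ∀ s ∈ uIoc 0 t, ‖H n (X n s) - G (Y s)‖ ≤ ε / (t + 1) := by
      intro s hs
      rw [uIoc_of_le ht] at hs
      have ha := hn1 s ⟨hs.1.le, hs.2⟩
      have hb := hHG n (X n s)
      rw [dist_comm] at ha
      rw [← dist_eq_norm]
      have h4 := dist_triangle (H n (X n s)) (G (X n s)) (G (Y s))
      have h5 : ε / (t + 1) = 2 * (ε / (2 * (t + 1))) := by field_simp
      linarith
    refine (intervalIntegral.norm_integral_le_of_norm_le_const hb).trans_lt ?_
    rw [sub_zero, abs_of_nonneg ht, div_mul_eq_mul_div, div_lt_iff₀ (by positivity)]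
    nlinarith
  · exact ((hHc n).comp (X n).continuous).intervalIntegrable _ _
  · exact (hG.comp Y.continuous).intervalIntegrable _ _

/-! ### Matrices, quadratic forms, hitting times -/

theorem mulEuc_smul {m n : ℕ} (A : Matrix (Fin m) (Fin n) ℝ) (c : ℝ) (x : Euc n) :
    mulEuc A (c • x) = c • mulEuc A x := by
  simp [mulEuc, Matrix.mulVec_smul]

theorem mulEuc_mulEuc {l m n : ℕ} (A : Matrix (Fin l) (Fin m) ℝ) (B : Matrix (Fin m) (Fin n) ℝ)
    (x : Euc n) : mulEuc A (mulEuc B x) = mulEuc (A * B) x := by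
  simp [mulEuc, Matrix.mulVec_mulVec]

theorem inner_mulEuc {m n : ℕ} (A : Matrix (Fin m) (Fin n) ℝ) (x : Euc m) (y : Euc n) :
    inner ℝ (mulEuc A y) x = inner ℝ y (mulEuc A.transpose x) := by
  simp only [mulEuc, EuclideanSpace.inner_eq_star_dotProduct, star_trivial]
  rw [Matrix.dotProduct_mulVec, Matrix.mulVec_transpose]

theorem quadForm_smul {n : ℕ} (A : Matrix (Fin n) (Fin n) ℝ) (c : ℝ) (x : Euc n) :
    quadForm A (c • x) = c ^ 2 * quadForm A x := by
  simp only [quadForm, mulEuc_smul, inner_smul_left, inner_smul_right, conj_trivial]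
  ring

theorem quadForm_zero {n : ℕ} (A : Matrix (Fin n) (Fin n) ℝ) : quadForm A 0 = 0 := by
  simp [quadForm]

theorem quadForm_sub_of_symm {n : ℕ} {A : Matrix (Fin n) (Fin n) ℝ} (hA : A.transpose = A)
    (x y : Euc n) :
    quadForm A (x - y) = quadForm A x - 2 * inner ℝ x (mulEuc A y) + quadForm A y := by
  have h : mulEuc A (x - y) = mulEuc A x - mulEuc A y := by
    simp [mulEuc, Matrix.mulVec_sub]
  have h' : inner ℝ y (mulEuc A x) = inner ℝ x (mulEuc A y) := by
    conv_lhs => rw [← hA, ← inner_mulEuc, real_inner_comm]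
  simp only [quadForm, h, inner_sub_left, inner_sub_right, h']
  ring

theorem continuous_mulEuc {m n : ℕ} {Y : Type*} [TopologicalSpace Y]
    {A : Y → Matrix (Fin m) (Fin n) ℝ} {x : Y → Euc n} (hA : Continuous A) (hx : Continuous x) :
    Continuous fun y => mulEuc (A y) (x y) := by
  unfold mulEuc
  refine (PiLp.continuous_toLp 2 _).comp (hA.matrix_mulVec ?_)
  exact (PiLp.continuous_ofLp 2 _).comp hx

theorem continuous_quadForm {n : ℕ} (A : Matrix (Fin n) (Fin n) ℝ) : Continuous (quadForm A) :=
  continuous_id.inner (continuous_mulEuc continuous_const continuous_id)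

/-- A positive definite quadratic form is coercive. -/
theorem exists_mul_sq_norm_le_quadForm {n : ℕ} {A : Matrix (Fin n) (Fin n) ℝ}
    (hA : ∀ x : Euc n, x ≠ 0 → 0 < quadForm A x) :
    ∃ c > 0, ∀ x : Euc n, c * ‖x‖ ^ 2 ≤ quadForm A x := by
  -- The unit sphere is empty in dimension zero.
  rcases (sphere (0 : Euc n) 1).eq_empty_or_nonempty with he | hne
  · refine ⟨1, one_pos, fun x => ?_⟩
    rcases eq_or_ne x 0 with rfl | hx
    · simp [quadForm_zero]
    · have : (‖x‖⁻¹ • x) ∈ sphere (0 : Euc n) 1 := by simp [norm_smul, hx]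
      simp [he] at this
  · obtain ⟨z, hz, hmin⟩ := (isCompact_sphere (0 : Euc n) 1).exists_isMinOn hne
      (continuous_quadForm A).continuousOn
    have hz0 : z ≠ 0 := by rintro rfl; simp at hz
    refine ⟨quadForm A z, hA z hz0, fun x => ?_⟩
    rcases eq_or_ne x 0 with rfl | hx
    · simp [quadForm_zero]
    · have hm : (‖x‖⁻¹ • x) ∈ sphere (0 : Euc n) 1 := by simp [norm_smul, hx]
      have h1 : quadForm A z ≤ quadForm A (‖x‖⁻¹ • x) := hmin hm
      rw [quadForm_smul, inv_pow, inv_mul_eq_div, le_div_iff₀ (by positivity)] at h1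
      exact h1

/-- Matrices depending continuously on a parameter are uniformly bounded over compact sets. -/
theorem IsCompact.exists_norm_mulEuc_le {m n : ℕ} {Y : Type*} [TopologicalSpace Y]
    {A : Y → Matrix (Fin m) (Fin n) ℝ} (hA : Continuous A) {K : Set Y} (hK : IsCompact K) :
    ∃ C, 0 ≤ C ∧ ∀ y ∈ K, ∀ u : Euc n, ‖mulEuc (A y) u‖ ≤ C * ‖u‖ := by
  have hc : Continuous fun p : Y × Euc n => mulEuc (A p.1) p.2 :=
    continuous_mulEuc (hA.comp continuous_fst) continuous_snd
  obtain ⟨C, hC⟩ := (hK.prod (isCompact_closedBall (0 : Euc n) 1)).exists_bound_of_continuousOn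
    hc.continuousOn
  refine ⟨max C 0, le_max_right _ _, fun y hy u => ?_⟩
  rcases eq_or_ne u 0 with rfl | hu
  · simp [mulEuc]
  · have h1 := hC (y, ‖u‖⁻¹ • u) ⟨hy, by simp [norm_smul, hu]⟩
    simp only [mulEuc_smul, norm_smul, norm_inv, norm_norm] at h1
    rw [inv_mul_eq_div, div_le_iff₀ (by positivity)] at h1
    exact h1.trans (by gcongr; exact le_max_left _ _)

/-- A continuous function on `[0,∞)` reaching a level from below has a first hitting time. -/
theorem exists_first_hitting_time {φ : ℝ → ℝ} (hφ : ContinuousOn φ (Ici 0)) {δ : ℝ}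
    (h0 : φ 0 < δ) {t : ℝ} (ht : 0 ≤ t) (hδ : δ ≤ φ t) :
    ∃ τ, 0 ≤ τ ∧ φ τ = δ ∧ ∀ s ∈ Icc 0 τ, φ s ≤ δ := by
  have hc : ContinuousOn φ (Icc 0 t) := hφ.mono Icc_subset_Ici_self
  have hcl : IsCompact (Icc 0 t ∩ φ ⁻¹' {δ}) :=
    isCompact_Icc.of_isClosed_subset (hc.preimage_isClosed_of_isClosed isClosed_Icc
      isClosed_singleton) inter_subset_left
  obtain ⟨s, hs, hsδ⟩ := intermediate_value_Icc ht hc ⟨h0.le, hδ⟩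
  obtain ⟨τ, ⟨hτ, hτδ⟩, hmin⟩ := hcl.exists_isLeast ⟨s, hs, hsδ⟩
  refine ⟨τ, hτ.1, hτδ, fun s hs => ?_⟩
  by_contra! hlt
  obtain ⟨s', hs', hs'δ⟩ := intermediate_value_Icc hs.1
    (hφ.mono Icc_subset_Ici_self : ContinuousOn φ (Icc 0 s)) ⟨h0.le, hlt.le⟩
  have h1 : τ ≤ s' := hmin ⟨⟨hs'.1, hs'.2.trans (hs.2.trans hτ.2)⟩, hs'δ⟩
  have h2 : s = τ := le_antisymm hs.2 (h1.trans hs'.2)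
  rw [h2] at hlt
  exact hlt.ne' hτδ

/-! ### Admissible data and the completed square -/

namespace ControlProblem

variable {N M : ℕ} {P : ControlProblem N M}

theorem Admissible.continuous_g (hP : P.Admissible) : Continuous P.g :=
  continuous_matrix fun i j => (hP.contDiff_g i j).continuous

theorem Admissible.continuous_vectorField (hP : P.Admissible) :
    Continuous fun p : Euc N × Euc M => P.f p.1 + mulEuc (P.g p.1) p.2 :=
  (hP.contDiff_f.continuous.comp continuous_fst).add
    (continuous_mulEuc (hP.continuous_g.comp continuous_fst) continuous_snd)

theorem Admissible.continuous_runningCost (hP : P.Admissible) :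
    Continuous fun p : Euc N × Euc M => P.h p.1 + quadForm P.R p.2 :=
  (hP.contDiff_h.continuous.comp continuous_fst).add ((continuous_quadForm _).comp continuous_snd)

theorem Admissible.quadForm_nonneg (hP : P.Admissible) (u : Euc M) : 0 ≤ quadForm P.R u := by
  rcases eq_or_ne u 0 with rfl | hu
  · exact (quadForm_zero _).ge
  · exact (hP.pos_R u hu).le

theorem Admissible.h_nonneg (hP : P.Admissible) (x : Euc N) : 0 ≤ P.h x := by
  rcases eq_or_ne x 0 with rfl | hx
  · exact hP.h_zero.ge
  · exact (hP.h_pos x hx).le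

theorem Admissible.runningCost_nonneg (hP : P.Admissible) (x : Euc N) (u : Euc M) :
    0 ≤ P.h x + quadForm P.R u :=
  add_nonneg (hP.h_nonneg x) (hP.quadForm_nonneg u)

theorem Admissible.isUnit_R (hP : P.Admissible) : IsUnit P.R := by
  rw [← Matrix.mulVec_injective_iff_isUnit]
  refine (injective_iff_map_eq_zero P.R.mulVecLin).2 fun u hu => ?_
  by_contra hne
  have h0 : (WithLp.toLp 2 u : Euc M) ≠ 0 := by simpa using hne
  have := hP.pos_R _ h0
  have hu' : P.R.mulVec u = 0 := hu
  simp [quadForm, mulEuc, hu'] at this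

/-- Removing `R⁻¹` turns the term linear in the control into the cross term of a square centred at
the feedback. -/
theorem Admissible.mulEuc_R_feedback (hP : P.Admissible) (v : Euc N → ℝ) (x : Euc N) :
    mulEuc P.R (P.feedback v x)
      = (-(1 / 2) : ℝ) • mulEuc (P.g x).transpose (gradient v x) := by
  have hR : P.R * P.R⁻¹ = 1 :=
    Matrix.mul_nonsing_inv _ ((Matrix.isUnit_iff_isUnit_det _).1 hP.isUnit_R)
  rw [feedback, mulEuc_smul, mulEuc_mulEuc, ← Matrix.mul_assoc, hR, Matrix.one_mul]

/-- Completion of the square in the Hamilton-Jacobi-Bellman identity. -/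
theorem SolvesHJB.inner_gradient_eq (hP : P.Admissible) {v : Euc N → ℝ} {Ω : Set (Euc N)}
    (hv : P.SolvesHJB v Ω) {x : Euc N} (hx : x ∈ Ω) (u : Euc M) :
    inner ℝ (gradient v x) (P.f x + mulEuc (P.g x) u)
      = -(P.h x + quadForm P.R u) + quadForm P.R (u - P.feedback v x) := by
  have key (w : Euc M) : inner ℝ (mulEuc (P.g x) w) (gradient v x)
      = -2 * inner ℝ w (mulEuc P.R (P.feedback v x)) := by
    rw [hP.mulEuc_R_feedback, inner_smul_right, inner_mulEuc]
    ring
  have h1 := hv x hx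
  rw [inner_add_left, key] at h1
  rw [real_inner_comm, inner_add_left, key, quadForm_sub_of_symm hP.symm_R]
  have h2 : quadForm P.R (P.feedback v x)
    = inner ℝ (P.feedback v x) (mulEuc P.R (P.feedback v x)) := rfl
  linarith

theorem hasGradientAt_of_contDiffOn {v : Euc N → ℝ} {Ω : Set (Euc N)} (hΩ : IsOpen Ω)
    (hv : ContDiffOn ℝ 1 v Ω) {x : Euc N} (hx : x ∈ Ω) : HasGradientAt v (gradient v x) x :=
  ((hv.differentiableOn (by decide)).differentiableAt (hΩ.mem_nhds hx)).hasGradientAt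

theorem continuousOn_gradient {v : Euc N → ℝ} {Ω : Set (Euc N)} (hΩ : IsOpen Ω)
    (hv : ContDiffOn ℝ 1 v Ω) : ContinuousOn (gradient v) Ω :=
  (InnerProductSpace.toDual ℝ (Euc N)).symm.continuous.comp_continuousOn
    (hv.continuousOn_fderiv_of_isOpen hΩ le_rfl)

theorem Admissible.continuousOn_feedback (hP : P.Admissible) {v : Euc N → ℝ} {Ω : Set (Euc N)}
    (hΩ : IsOpen Ω) (hv : ContDiffOn ℝ 1 v Ω) : ContinuousOn (P.feedback v) Ω := by
  have hc : Continuous fun p : Euc N × Euc N => mulEuc (P.R⁻¹ * (P.g p.1).transpose) p.2 :=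
    continuous_mulEuc (continuous_const.matrix_mul
      (hP.continuous_g.comp continuous_fst).matrix_transpose) continuous_snd
  have h : ContinuousOn (fun x => mulEuc (P.R⁻¹ * (P.g x).transpose) (gradient v x)) Ω :=
    hc.comp_continuousOn (f := fun x => (x, gradient v x))
      (continuousOn_id.prodMk (continuousOn_gradient hΩ hv))
  exact h.const_smul (-(1 / 2) : ℝ)

/-- Derivative of a function along a differentiable curve, in terms of the gradient. -/
theorem _root_.HasGradientAt.hasDerivAt_comp {v : Euc N → ℝ} {p : Euc N} {X : ℝ → Euc N}
    {X' : Euc N} {t : ℝ} (hv : HasGradientAt v p (X t)) (hX : HasDerivAt X X' t) :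
    HasDerivAt (fun s => v (X s)) (inner ℝ p X') t := by
  have := hv.hasFDerivAt.comp_hasDerivAt t hX
  simpa using! this

/-! ### Integrability along inputs, and the cost -/

theorem IsInput.exists_norm_le {u : ℝ → Euc M} (hu : IsInput u) :
    ∃ B : ℝ, ∀ᵐ t, 0 ≤ t → ‖u t‖ ≤ B := by
  have hfin : eLpNormEssSup u (volume.restrict (Ici (0 : ℝ))) < ∞ := by
    rw [← eLpNorm_exponent_top]
    exact MemLp.eLpNorm_lt_top hu
  refine ⟨(eLpNormEssSup u (volume.restrict (Ici (0 : ℝ)))).toReal, ?_⟩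
  have := ae_le_eLpNormEssSup (f := u) (μ := volume.restrict (Ici (0 : ℝ)))
  rw [ae_restrict_iff' measurableSet_Ici] at this
  filter_upwards [this] with t ht ht0
  rw [← toReal_enorm]
  exact ENNReal.toReal_mono hfin.ne (ht ht0)

theorem IsInput.aestronglyMeasurable_comp {u : ℝ → Euc M} (hu : IsInput u) {X : ℝ → Euc N}
    (hX : ContinuousOn X (Ici 0)) {F : Type*} [NormedAddCommGroup F]
    {Φ : Euc N × Euc M → F} (hΦ : Continuous Φ) :
    AEStronglyMeasurable (fun s => Φ (X s, u s)) (volume.restrict (Ici 0)) :=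
  hΦ.comp_aestronglyMeasurable
    ((hX.aestronglyMeasurable measurableSet_Ici).prodMk hu.aestronglyMeasurable)

/-- Continuous functions of state and input are essentially bounded on bounded time intervals. -/
theorem IsInput.exists_norm_comp_le {u : ℝ → Euc M} (hu : IsInput u) {X : ℝ → Euc N}
    (hX : ContinuousOn X (Ici 0)) {F : Type*} [NormedAddCommGroup F]
    {Φ : Euc N × Euc M → F} (hΦ : Continuous Φ) (T : ℝ) :
    ∃ C : ℝ, ∀ᵐ s, s ∈ Icc 0 T → ‖Φ (X s, u s)‖ ≤ C := by
  obtain ⟨B, hB⟩ := hu.exists_norm_le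
  have hK : IsCompact (X '' Icc 0 T) := isCompact_Icc.image_of_continuousOn
    (hX.mono Icc_subset_Ici_self)
  obtain ⟨C, hC⟩ := (hK.prod (isCompact_closedBall (0 : Euc M) B)).exists_bound_of_continuousOn
    hΦ.continuousOn
  refine ⟨C, ?_⟩
  filter_upwards [hB] with s hs hsT
  exact hC _ ⟨mem_image_of_mem _ hsT, by simpa using hs hsT.1⟩

/-- A general continuous `Φ` covers both the vector field and the running cost. -/
theorem IsInput.intervalIntegrable_comp {u : ℝ → Euc M} (hu : IsInput u) {X : ℝ → Euc N}
    (hX : ContinuousOn X (Ici 0)) {F : Type*} [NormedAddCommGroup F]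
    {Φ : Euc N × Euc M → F} (hΦ : Continuous Φ) {a b : ℝ} (ha : 0 ≤ a) (hb : 0 ≤ b) :
    IntervalIntegrable (fun s => Φ (X s, u s)) volume a b := by
  have h0 (T : ℝ) (hT : 0 ≤ T) : IntervalIntegrable (fun s => Φ (X s, u s)) volume 0 T := by
    obtain ⟨C, hC⟩ := hu.exists_norm_comp_le hX hΦ T
    rw [intervalIntegrable_iff_integrableOn_Icc_of_le hT]
    refine IntegrableOn.of_bound (by simp) ((hu.aestronglyMeasurable_comp hX hΦ).mono_measure
      (Measure.restrict_mono Icc_subset_Ici_self le_rfl)) C ?_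
    rw [ae_restrict_iff' measurableSet_Icc]
    exact hC
  exact (h0 a ha).symm.trans (h0 b hb)

theorem Admissible.integral_runningCost_le_cost (hP : P.Admissible) {u : ℝ → Euc M}
    (hu : IsInput u) {X : ℝ → Euc N} (hX : ContinuousOn X (Ici 0)) {T : ℝ} (hT : 0 ≤ T) :
    ENNReal.ofReal (∫ s in (0 : ℝ)..T, (P.h (X s) + quadForm P.R (u s))) ≤ P.cost u X := by
  have hint := hu.intervalIntegrable_comp hX hP.continuous_runningCost le_rfl hT
  rw [intervalIntegral.integral_of_le hT, ofReal_integral_eq_lintegral_ofReal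
    ((intervalIntegrable_iff_integrableOn_Ioc_of_le hT).1 hint)
    (Eventually.of_forall fun s => hP.runningCost_nonneg _ _)]
  exact lintegral_mono_set fun s hs => hs.1.le

/-- Monotone convergence along the intervals `(0,n]`. -/
theorem Admissible.cost_le_of_forall_integral_le (hP : P.Admissible) {u : ℝ → Euc M}
    (hu : IsInput u) {X : ℝ → Euc N} (hX : ContinuousOn X (Ici 0)) {c : ℝ}
    (hc : ∀ T, 0 ≤ T → ∫ s in (0 : ℝ)..T, (P.h (X s) + quadForm P.R (u s)) ≤ c) :
    P.cost u X ≤ ENNReal.ofReal c := by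
  have hU : Ioi (0 : ℝ) = ⋃ n : ℕ, Ioc (0 : ℝ) n := by
    ext t
    simp only [mem_Ioi, mem_iUnion, mem_Ioc]
    exact ⟨fun h => (exists_nat_ge t).imp fun n hn => ⟨h, hn⟩, fun ⟨_, h⟩ => h.1⟩
  rw [cost, setLIntegral_congr Ioi_ae_eq_Ici.symm, hU, setLIntegral_iUnion_of_directed]
  · refine iSup_le fun n => ?_
    have hn : (0 : ℝ) ≤ n := Nat.cast_nonneg n
    have hint := hu.intervalIntegrable_comp hX hP.continuous_runningCost le_rfl hn
    rw [← ofReal_integral_eq_lintegral_ofReal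
      ((intervalIntegrable_iff_integrableOn_Ioc_of_le hn).1 hint)
      (Eventually.of_forall fun s => hP.runningCost_nonneg _ _),
      ← intervalIntegral.integral_of_le hn]
    exact ENNReal.ofReal_le_ofReal (hc n hn)
  · exact directed_of_isDirected_le fun m n hmn =>
      Ioc_subset_Ioc_right (by exact_mod_cast hmn)

/-- A state-input pair along which `h` stays away from zero has infinite cost. -/
theorem Admissible.cost_eq_top (hP : P.Admissible) {u : ℝ → Euc M} {X : ℝ → Euc N} {c : ℝ}
    (hc : 0 < c) (h : ∀ t, 0 ≤ t → c ≤ P.h (X t)) : P.cost u X = ∞ := by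
  rw [eq_top_iff]
  calc ∞ = ∫⁻ _ in Ici (0 : ℝ), ENNReal.ofReal c := by
        simp [hc]
    _ ≤ _ := setLIntegral_mono' measurableSet_Ici fun t ht =>
        ENNReal.ofReal_le_ofReal ((h t ht).trans (by linarith [hP.quadForm_nonneg (u t)]))

/-! ### Regularity and time shifts of trajectories -/

variable {x : Euc N} {u : ℝ → Euc M} {X : ℝ → Euc N}

theorem IsTrajectory.zero_eq (hX : P.IsTrajectory x u X) : X 0 = x := by
  simpa using hX.integral_eq 0 le_rfl

theorem IsTrajectory.sub_eq_integral (hX : P.IsTrajectory x u X) (hP : P.Admissible)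
    (hu : IsInput u) {s t : ℝ} (hs : 0 ≤ s) (ht : 0 ≤ t) :
    X t - X s = ∫ τ in s..t, (P.f (X τ) + mulEuc (P.g (X τ)) (u τ)) := by
  have hi {a b : ℝ} (ha : 0 ≤ a) (hb : 0 ≤ b) :=
    hu.intervalIntegrable_comp hX.continuousOn hP.continuous_vectorField ha hb
  rw [hX.integral_eq t ht, hX.integral_eq s hs, add_sub_add_left_eq_sub,
    intervalIntegral.integral_interval_sub_left (hi le_rfl ht) (hi le_rfl hs)]

/-- The velocity is essentially bounded on `[0,T]`. This is what later makes `v ∘ X` absolutely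
continuous. -/
theorem IsTrajectory.exists_lipschitzOnWith (hX : P.IsTrajectory x u X) (hP : P.Admissible)
    (hu : IsInput u) (T : ℝ) : ∃ K : ℝ≥0, LipschitzOnWith K X (Icc 0 T) := by
  obtain ⟨C, hC⟩ := hu.exists_norm_comp_le hX.continuousOn hP.continuous_vectorField T
  refine ⟨C.toNNReal, LipschitzOnWith.of_dist_le_mul fun s hs t ht => ?_⟩
  rw [dist_eq_norm, hX.sub_eq_integral hP hu ht.1 hs.1, Real.dist_eq]
  refine intervalIntegral.norm_integral_le_of_norm_le_const_ae ?_
  filter_upwards [hC] with τ hτ hmem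
  exact (hτ (uIcc_subset_Icc ht hs (uIoc_subset_uIcc hmem))).trans (Real.le_coe_toNNReal C)

/-- Lebesgue differentiation of the integral equation. The time `0` is discarded because the
equation says nothing about negative times. -/
theorem IsTrajectory.ae_hasDerivAt (hX : P.IsTrajectory x u X) (hP : P.Admissible)
    (hu : IsInput u) {T : ℝ} (hT : 0 ≤ T) :
    ∀ᵐ t, t ∈ Icc 0 T → HasDerivAt X (P.f (X t) + mulEuc (P.g (X t)) (u t)) t := by
  have hi := hu.intervalIntegrable_comp hX.continuousOn hP.continuous_vectorField le_rfl hT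
  have hne : ∀ᵐ t : ℝ, t ≠ 0 := by simp [ae_iff, measure_singleton]
  filter_upwards [hi.ae_hasDerivAt_integral, hne] with t ht ht0 hmem
  rw [uIcc_of_le hT] at ht
  refine ((ht hmem 0 ⟨le_rfl, hT⟩).const_add x).congr_of_eventuallyEq ?_
  filter_upwards [Ioi_mem_nhds (lt_of_le_of_ne hmem.1 ht0.symm)] with s hs
  exact hX.integral_eq s (le_of_lt hs)

theorem IsInput.comp_add_right (hu : IsInput u) {t : ℝ} (ht : 0 ≤ t) :
    IsInput fun s => u (s + t) := by
  have hmp := (measurePreserving_add_right volume t).restrict_preimage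
    (measurableSet_Ici (a := (t : ℝ)))
  have hpre : (fun s : ℝ => s + t) ⁻¹' Ici t = Ici 0 := by ext; simp
  rw [hpre] at hmp
  exact (MemLp.mono_measure (Measure.restrict_mono (Ici_subset_Ici.2 ht) le_rfl) hu
    : MemLp u ∞ (volume.restrict (Ici t))).comp_measurePreserving hmp

theorem IsTrajectory.comp_add_right (hX : P.IsTrajectory x u X) (hP : P.Admissible)
    (hu : IsInput u) {t : ℝ} (ht : 0 ≤ t) :
    P.IsTrajectory (X t) (fun s => u (s + t)) (fun s => X (s + t)) where
  continuousOn := hX.continuousOn.comp (by fun_prop) fun s hs => add_nonneg hs ht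
  integral_eq s hs := by
    rw [intervalIntegral.integral_comp_add_right
      (fun τ => P.f (X τ) + mulEuc (P.g (X τ)) (u τ)), zero_add,
      ← hX.sub_eq_integral hP hu ht (add_nonneg hs ht)]
    abel

theorem cost_comp_add_right_le (P : ControlProblem N M) (u : ℝ → Euc M) (X : ℝ → Euc N) {t : ℝ}
    (ht : 0 ≤ t) : P.cost (fun s => u (s + t)) (fun s => X (s + t)) ≤ P.cost u X := by
  have hpre : (fun s : ℝ => s + t) ⁻¹' Ici t = Ici 0 := by ext; simp
  have h := (measurePreserving_add_right volume t).setLIntegral_comp_preimage_emb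
    (measurableEmbedding_addRight t)
    (fun τ => ENNReal.ofReal (P.h (X τ) + quadForm P.R (u τ))) (Ici t)
  rw [hpre] at h
  rw [cost, h]
  exact lintegral_mono_set (Ici_subset_Ici.2 ht)

theorem IsTrajectory.optimalValue_le_cost (hX : P.IsTrajectory x u X) (hu : IsInput u) :
    P.optimalValue x ≤ P.cost u X :=
  (iInf₂_le u hu).trans (iInf₂_le X hX)

/-- The optimal value along a trajectory is bounded by the total cost. -/
theorem IsTrajectory.optimalValue_apply_le_cost (hX : P.IsTrajectory x u X) (hP : P.Admissible)
    (hu : IsInput u) {t : ℝ} (ht : 0 ≤ t) : P.optimalValue (X t) ≤ P.cost u X :=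
  ((hX.comp_add_right hP hu ht).optimalValue_le_cost (hu.comp_add_right ht)).trans
    (P.cost_comp_add_right_le u X ht)

theorem Admissible.optimalValue_zero (hP : P.Admissible) : P.optimalValue 0 = 0 := by
  have htr : P.IsTrajectory 0 (fun _ => 0) (fun _ => 0) :=
    ⟨continuousOn_const, fun t _ => by simp [hP.f_zero, mulEuc]⟩
  have hin : IsInput (fun _ => (0 : Euc M)) := MemLp.zero
  have := htr.optimalValue_le_cost hin
  simpa [cost, hP.h_zero, quadForm_zero] using this

end ControlProblem

/-! ### Upper bound: the closed loop -/

/-- Radial retraction onto the closed ball of radius `r`. -/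
noncomputable def radialRetraction {E : Type*} [NormedAddCommGroup E] [NormedSpace ℝ E] (r : ℝ) (y : E) : E :=
  (r / max r ‖y‖) • y

theorem continuous_radialRetraction {E : Type*} [NormedAddCommGroup E] [NormedSpace ℝ E] {r : ℝ}
    (hr : 0 < r) : Continuous (radialRetraction r : E → E) := by
  unfold radialRetraction
  exact (continuous_const.div (continuous_const.max continuous_norm)
    fun y => (hr.trans_le (le_max_left _ _)).ne').smul continuous_id

theorem radialRetraction_mem_closedBall {E : Type*} [NormedAddCommGroup E] [NormedSpace ℝ E]
    {r : ℝ} (hr : 0 < r) (y : E) : radialRetraction r y ∈ closedBall (0 : E) r := by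
  have hm : 0 < max r ‖y‖ := hr.trans_le (le_max_left _ _)
  rw [mem_closedBall_zero_iff, radialRetraction, norm_smul, Real.norm_eq_abs,
    abs_of_nonneg (by positivity), div_mul_eq_mul_div, div_le_iff₀ hm]
  gcongr
  exact le_max_right _ _

theorem radialRetraction_of_mem {E : Type*} [NormedAddCommGroup E] [NormedSpace ℝ E]
    {r : ℝ} (hr : 0 < r) {y : E} (hy : ‖y‖ ≤ r) : radialRetraction r y = y := by
  rw [radialRetraction, max_eq_left hy, div_self hr.ne', one_smul]

namespace ControlProblem

variable {N M : ℕ} {P : ControlProblem N M} {Ω : Set (Euc N)} {v : Euc N → ℝ} {x : Euc N}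
  {r α β : ℝ}

/-- The closed loop system of a solution of the Hamilton-Jacobi-Bellman equation dissipates `v`
at the rate of the running cost. -/
theorem SolvesHJB.integral_runningCost_eq (hv : P.SolvesHJB v Ω) (hP : P.Admissible)
    (hΩ : IsOpen Ω) (hv1 : ContDiffOn ℝ 1 v Ω) {X : ℝ → Euc N} {T : ℝ} (hT : 0 ≤ T)
    (hXc : ContinuousOn X (Icc 0 T)) (hXΩ : ∀ t ∈ Icc 0 T, X t ∈ Ω)
    (hX : ∀ t ∈ Ioo 0 T, HasDerivAt X (P.f (X t) + mulEuc (P.g (X t)) (P.feedback v (X t))) t) :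
    ∫ s in (0 : ℝ)..T, (P.h (X s) + quadForm P.R (P.feedback v (X s))) = v (X 0) - v (X T) := by
  have hcost : ContinuousOn (fun s => P.h (X s) + quadForm P.R (P.feedback v (X s)))
      (Icc 0 T) :=
    (hP.contDiff_h.continuous.comp_continuousOn hXc).add
      ((continuous_quadForm _).comp_continuousOn ((hP.continuousOn_feedback hΩ hv1).comp hXc hXΩ))
  have h := intervalIntegral.integral_eq_sub_of_hasDerivAt_of_le hT
    (f := fun s => v (X s)) (f' := fun s => -(P.h (X s) + quadForm P.R (P.feedback v (X s))))
    (hv1.continuousOn.comp hXc hXΩ) (fun t ht => by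
      have hm := hXΩ t (Ioo_subset_Icc_self ht)
      have h1 := (hasGradientAt_of_contDiffOn hΩ hv1 hm).hasDerivAt_comp (hX t ht)
      rw [hv.inner_gradient_eq hP hm, sub_self, quadForm_zero, add_zero] at h1
      exact h1) (hcost.neg.intervalIntegrable_of_Icc hT)
  rw [intervalIntegral.integral_neg] at h
  linarith

/-- Near the origin, a coercive solution of the Hamilton-Jacobi-Bellman equation dominates the
optimal value. -/
theorem SolvesHJB.optimalValue_le (hv : P.SolvesHJB v Ω) (hP : P.Admissible)
    (hΩ : IsOpen Ω) (hv1 : ContDiffOn ℝ 1 v Ω) (hv0 : ∀ y ∈ Ω, 0 ≤ v y)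
    (hαβ : ∀ y ∈ Ω, α * ‖y‖ ^ 2 ≤ v y ∧ v y ≤ β * ‖y‖ ^ 2) (hr : 0 < r)
    (hrΩ : closedBall 0 r ⊆ Ω) (hxr : ‖x‖ < r) (hx : β * ‖x‖ ^ 2 < α * r ^ 2) :
    P.optimalValue x ≤ ENNReal.ofReal (v x) := by
  -- Precomposing with the retraction gives a bounded continuous field on the whole space, as
  -- Peano's theorem requires; it is the true closed loop as long as `‖X‖ ≤ r`.
  have hρc := continuous_radialRetraction (E := Euc N) hr
  have hρm (y : Euc N) : radialRetraction r y ∈ Ω := hrΩ (radialRetraction_mem_closedBall hr y)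
  have hfb := hP.continuousOn_feedback hΩ hv1
  set U : Euc N → Euc M := fun y => P.feedback v (radialRetraction r y) with hU
  have hUc : Continuous U := hfb.comp_continuous hρc hρm
  set G : Euc N → Euc N := fun y =>
    P.f (radialRetraction r y) + mulEuc (P.g (radialRetraction r y)) (U y) with hG
  have hGc : Continuous G := hP.continuous_vectorField.comp (hρc.prodMk hUc)
  have hFb : ContinuousOn (fun y => P.f y + mulEuc (P.g y) (P.feedback v y))
      (closedBall 0 r) :=
    hP.continuous_vectorField.comp_continuousOn (f := fun y => (y, P.feedback v y))
      (continuousOn_id.prodMk (hfb.mono hrΩ))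
  obtain ⟨L, hL⟩ := (isCompact_closedBall (0 : Euc N) r).exists_bound_of_continuousOn hFb
  obtain ⟨B, hB⟩ := (isCompact_closedBall (0 : Euc N) r).exists_bound_of_continuousOn
    (hfb.mono hrΩ)
  obtain ⟨X, hXc, hX⟩ := ODE.exists_eq_add_integral_of_continuous hGc
    (fun y => hL _ (radialRetraction_mem_closedBall hr y)) x
  have hX0 : X 0 = x := by simpa using hX 0 le_rfl
  have hderiv {t : ℝ} (ht : 0 < t) : HasDerivAt X (G (X t)) t := by
    have h1 : HasDerivAt (fun t => x + ∫ s in (0 : ℝ)..t, G (X s)) (G (X t)) t :=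
      ((hGc.comp hXc).integral_hasStrictDerivAt 0 t).hasDerivAt.const_add x
    refine h1.congr_of_eventuallyEq ?_
    filter_upwards [Ioi_mem_nhds ht] with s hs using hX s (le_of_lt hs)
  have hident {T : ℝ} (hT : 0 ≤ T) (hin : ∀ t ∈ Icc 0 T, ‖X t‖ ≤ r) :
      ∫ s in (0 : ℝ)..T, (P.h (X s) + quadForm P.R (P.feedback v (X s))) = v x - v (X T) := by
    rw [← hX0]
    refine hv.integral_runningCost_eq hP hΩ hv1 hT hXc.continuousOn
      (fun t ht => hrΩ (mem_closedBall_zero_iff.2 (hin t ht))) fun t ht => ?_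
    have h1 := hderiv ht.1
    simp only [hG, hU, radialRetraction_of_mem hr (hin t (Ioo_subset_Icc_self ht))] at h1
    exact h1
  -- At a first hitting time of the sphere, `αr² ≤ v(X τ) ≤ v(x) ≤ β‖x‖²`, against `hx`.
  have hstay : ∀ t, 0 ≤ t → ‖X t‖ ≤ r := by
    intro t ht
    by_contra! hlt
    obtain ⟨τ, hτ0, hτ, hin⟩ := exists_first_hitting_time (φ := fun t => ‖X t‖)
      hXc.norm.continuousOn (by simpa [hX0] using hxr) ht hlt.le
    have h1 := hident hτ0 hin
    have h2 : 0 ≤ ∫ s in (0 : ℝ)..τ, (P.h (X s) + quadForm P.R (P.feedback v (X s))) :=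
      intervalIntegral.integral_nonneg hτ0 fun s _ => hP.runningCost_nonneg _ _
    have h3 := (hαβ (X τ) (hrΩ (mem_closedBall_zero_iff.2 hτ.le))).1
    have h4 := (hαβ x (hrΩ (mem_closedBall_zero_iff.2 hxr.le))).2
    rw [show ‖X τ‖ = r from hτ] at h3
    linarith
  have hUX {t : ℝ} (ht : 0 ≤ t) : U (X t) = P.feedback v (X t) := by
    simp only [hU, radialRetraction_of_mem hr (hstay t ht)]
  have hin : IsInput fun t => U (X t) :=
    memLp_top_of_bound (hUc.comp hXc).aestronglyMeasurable B
      (Eventually.of_forall fun t => hB _ (radialRetraction_mem_closedBall hr _))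
  have htr : P.IsTrajectory x (fun t => U (X t)) X := by
    refine ⟨hXc.continuousOn, fun t ht => ?_⟩
    rw [hX t ht]
    congr 1
    refine intervalIntegral.integral_congr fun s hs => ?_
    rw [uIcc_of_le ht] at hs
    simp only [hG, radialRetraction_of_mem hr (hstay s hs.1)]
  refine (htr.optimalValue_le_cost hin).trans
    (hP.cost_le_of_forall_integral_le hin hXc.continuousOn fun T hT => ?_)
  have h1 : ∫ s in (0 : ℝ)..T, (P.h (X s) + quadForm P.R (U (X s)))
      = ∫ s in (0 : ℝ)..T, (P.h (X s) + quadForm P.R (P.feedback v (X s))) := by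
    refine intervalIntegral.integral_congr fun s hs => ?_
    rw [uIcc_of_le hT] at hs
    simp only [hUX hs.1]
  rw [h1, hident hT fun t ht => hstay t ht.1]
  linarith [hv0 (X T) (hrΩ (mem_closedBall_zero_iff.2 (hstay T hT)))]

/-! ### Lower bound: trajectories confined to a ball -/

/-- A solution of the Hamilton-Jacobi-Bellman equation decreases along any trajectory at most by
the accumulated running cost. -/
theorem SolvesHJB.le_add_integral_runningCost (hv : P.SolvesHJB v Ω) (hP : P.Admissible)
    (hΩ : IsOpen Ω) (hv1 : ContDiffOn ℝ 1 v Ω) (hrΩ : closedBall 0 r ⊆ Ω) {u : ℝ → Euc M}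
    (hu : IsInput u) {X : ℝ → Euc N} (hX : P.IsTrajectory x u X)
    (hXr : ∀ t, 0 ≤ t → ‖X t‖ ≤ r) {T : ℝ} (hT : 0 ≤ T) :
    v x ≤ v (X T) + ∫ s in (0 : ℝ)..T, (P.h (X s) + quadForm P.R (u s)) := by
  obtain ⟨K₁, hK₁⟩ := hX.exists_lipschitzOnWith hP hu T
  obtain ⟨K₂, hK₂⟩ := (hv1.mono hrΩ).exists_lipschitzOnWith (by decide)
    (convex_closedBall 0 r) (isCompact_closedBall 0 r)
  -- Since `u` is only measurable, `v ∘ X` is differentiated almost everywhere and recovered from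
  -- its derivative by absolute continuity.
  have hlip : LipschitzOnWith (K₂ * K₁) (fun t => v (X t)) (uIcc 0 T) := by
    rw [uIcc_of_le hT]
    exact hK₂.comp hK₁ fun t ht => mem_closedBall_zero_iff.2 (hXr t ht.1)
  have hac := hlip.absolutelyContinuousOnInterval
  have hint := hu.intervalIntegrable_comp hX.continuousOn hP.continuous_runningCost le_rfl hT
  have hmono : ∫ s in (0 : ℝ)..T, -(P.h (X s) + quadForm P.R (u s))
      ≤ ∫ s in (0 : ℝ)..T, deriv (fun t => v (X t)) s := by
    refine intervalIntegral.integral_mono_ae_restrict hT hint.neg hac.intervalIntegrable_deriv ?_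
    refine (ae_restrict_iff' measurableSet_Icc).2 ?_
    filter_upwards [hX.ae_hasDerivAt hP hu hT] with t ht hmem
    have hm : X t ∈ Ω := hrΩ (mem_closedBall_zero_iff.2 (hXr t hmem.1))
    rw [((hasGradientAt_of_contDiffOn hΩ hv1 hm).hasDerivAt_comp (ht hmem)).deriv,
      hv.inner_gradient_eq hP hm]
    linarith [hP.quadForm_nonneg (u t - P.feedback v (X t))]
  rw [hac.integral_deriv_eq_sub, intervalIntegral.integral_neg, hX.zero_eq] at hmono
  linarith

/-- `h` is bounded below by a positive constant on compact sets avoiding the origin. -/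
theorem Admissible.exists_pos_le_h (hP : P.Admissible) {K : Set (Euc N)} (hK : IsCompact K)
    (h0 : (0 : Euc N) ∉ K) : ∃ c > 0, ∀ y ∈ K, c ≤ P.h y := by
  rcases K.eq_empty_or_nonempty with rfl | hne
  · exact ⟨1, one_pos, fun y hy => hy.elim⟩
  · obtain ⟨z, hz, hmin⟩ := hK.exists_isMinOn hne hP.contDiff_h.continuous.continuousOn
    exact ⟨P.h z, hP.h_pos z fun h => h0 (h ▸ hz), hmin⟩

/-- A solution of the Hamilton-Jacobi-Bellman equation bounded by `β ‖·‖²` is at most the cost of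
any trajectory staying near the origin. -/
theorem SolvesHJB.le_cost (hv : P.SolvesHJB v Ω) (hP : P.Admissible)
    (hΩ : IsOpen Ω) (hv1 : ContDiffOn ℝ 1 v Ω) (hβ : 0 < β)
    (hvβ : ∀ y ∈ Ω, v y ≤ β * ‖y‖ ^ 2) (hrΩ : closedBall 0 r ⊆ Ω) {u : ℝ → Euc M}
    (hu : IsInput u) {X : ℝ → Euc N} (hX : P.IsTrajectory x u X)
    (hXr : ∀ t, 0 ≤ t → ‖X t‖ ≤ r) : ENNReal.ofReal (v x) ≤ P.cost u X := by
  rcases eq_or_ne (P.cost u X) ∞ with htop | hfin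
  · simp [htop]
  refine ENNReal.ofReal_le_of_le_toReal (le_of_forall_pos_le_add fun ε hε => ?_)
  have hη : 0 < √(ε / β) := by positivity
  -- Otherwise `h` stays above a positive constant and the cost is infinite. The radius makes `v (X
  -- T) ≤ ε`.
  have hex : ∃ T, 0 ≤ T ∧ ‖X T‖ < √(ε / β) := by
    by_contra! hall
    obtain ⟨c, hc, hcK⟩ := hP.exists_pos_le_h
      ((isCompact_closedBall (0 : Euc N) r).diff (isOpen_ball (x := 0) (ε := √(ε / β))))
      (by simp [hη])
    refine hfin (hP.cost_eq_top hc fun t ht => hcK _ ⟨?_, ?_⟩)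
    · exact mem_closedBall_zero_iff.2 (hXr t ht)
    · simpa using hall t ht
  obtain ⟨T, hT, hXT⟩ := hex
  have h1 := hv.le_add_integral_runningCost hP hΩ hv1 hrΩ hu hX hXr hT
  have h2 := (ENNReal.ofReal_le_iff_le_toReal hfin).1
    (hP.integral_runningCost_le_cost hu hX.continuousOn hT)
  have h3 := hvβ (X T) (hrΩ (mem_closedBall_zero_iff.2 (hXr T hT)))
  have h4 : ‖X T‖ ^ 2 ≤ ε / β := by
    rw [← Real.sq_sqrt (by positivity : 0 ≤ ε / β)]
    gcongr
  have h5 : β * ‖X T‖ ^ 2 ≤ ε := by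
    calc β * ‖X T‖ ^ 2 ≤ β * (ε / β) := by gcongr
      _ = ε := by field_simp
  linarith

/-! ### Positivity of the optimal value, and confinement -/

/-- Away from the origin, the running cost controls the speed. -/
theorem Admissible.exists_mul_norm_vectorField_le (hP : P.Admissible) {K : Set (Euc N)}
    (hK : IsCompact K) (h0 : (0 : Euc N) ∉ K) :
    ∃ κ > 0, ∀ y ∈ K, ∀ u : Euc M,
      κ * ‖P.f y + mulEuc (P.g y) u‖ ≤ P.h y + quadForm P.R u := by
  obtain ⟨c, hc, hcK⟩ := hP.exists_pos_le_h hK h0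
  obtain ⟨l, hl, hlq⟩ := exists_mul_sq_norm_le_quadForm hP.pos_R
  obtain ⟨C, hC⟩ := hK.exists_bound_of_continuousOn hP.contDiff_f.continuous.continuousOn
  obtain ⟨D, hD0, hD⟩ := hK.exists_norm_mulEuc_le hP.continuous_g
  have hden : 0 < |C| + D ^ 2 / l + 1 := by positivity
  -- The factor 1 leaves `l‖u‖²` to the quadratic form; the quotient lets `h ≥ c` absorb `|C| +
  -- D²/l`, the rest of the bound on the speed.
  have hκ : 0 < min 1 (c / (|C| + D ^ 2 / l + 1)) := by positivity
  refine ⟨min 1 (c / (|C| + D ^ 2 / l + 1)), hκ, fun y hy u => ?_⟩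
  set κ := min 1 (c / (|C| + D ^ 2 / l + 1))
  have h1 : ‖P.f y + mulEuc (P.g y) u‖ ≤ |C| + D * ‖u‖ :=
    (norm_add_le _ _).trans (add_le_add ((hC y hy).trans (le_abs_self C)) (hD y hy u))
  have h2 : D * ‖u‖ ≤ D ^ 2 / l + l * ‖u‖ ^ 2 := by
    have : D ^ 2 / l + l * ‖u‖ ^ 2 - D * ‖u‖
        = ((D - l * ‖u‖) ^ 2 + D * (l * ‖u‖)) / l := by field_simp; ring
    have h3 : 0 ≤ ((D - l * ‖u‖) ^ 2 + D * (l * ‖u‖)) / l := by positivity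
    linarith
  have h3 : κ * (|C| + D ^ 2 / l) ≤ c := by
    have h4 : κ * (|C| + D ^ 2 / l + 1) ≤ c := by
      rw [← le_div_iff₀ hden]
      exact min_le_right _ _
    linarith
  have h5 : κ * (l * ‖u‖ ^ 2) ≤ 1 * (l * ‖u‖ ^ 2) := by
    gcongr
    exact min_le_left _ _
  calc κ * ‖P.f y + mulEuc (P.g y) u‖ ≤ κ * (|C| + (D ^ 2 / l + l * ‖u‖ ^ 2)) := by
        gcongr
        linarith
    _ = κ * (|C| + D ^ 2 / l) + κ * (l * ‖u‖ ^ 2) := by ring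
    _ ≤ P.h y + quadForm P.R u := by linarith [hcK y hy, hlq u]

/-- The optimal value is positive away from the origin. -/
theorem Admissible.optimalValue_pos (hP : P.Admissible) (hx : x ≠ 0) :
    0 < P.optimalValue x := by
  set δ := ‖x‖ / 2 with hδdef
  have hxn : 0 < ‖x‖ := norm_pos_iff.2 hx
  have hδ : 0 < δ := half_pos hxn
  have h0 : (0 : Euc N) ∉ closedBall x δ := by
    rw [mem_closedBall, dist_zero_left, not_le]
    exact half_lt_self hxn
  obtain ⟨κ, hκ, hκK⟩ := hP.exists_mul_norm_vectorField_le (isCompact_closedBall x δ) h0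
  obtain ⟨c, hc, hcK⟩ := hP.exists_pos_le_h (isCompact_closedBall x δ) h0
  refine (ENNReal.ofReal_pos.2 (mul_pos hκ hδ)).trans_le
    (le_iInf₂ fun u hu => le_iInf₂ fun X hX => ?_)
  -- Staying in the ball forever costs `∞`; leaving it means covering the distance `δ`, which costs
  -- at least `κ * δ`.
  by_cases hall : ∀ t, 0 ≤ t → dist (X t) x ≤ δ
  · rw [hP.cost_eq_top hc fun t ht => hcK _ (hall t ht)]
    exact le_top
  push Not at hall
  obtain ⟨t, ht, hlt⟩ := hall
  obtain ⟨τ, hτ0, hτ, hin⟩ := exists_first_hitting_time (φ := fun t => dist (X t) x)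
    ((continuous_id.dist continuous_const).comp_continuousOn hX.continuousOn) (by simpa [hX.zero_eq] using hδ) ht hlt.le
  refine le_trans (ENNReal.ofReal_le_ofReal ?_)
    (hP.integral_runningCost_le_cost hu hX.continuousOn hτ0)
  have hF := hu.intervalIntegrable_comp hX.continuousOn hP.continuous_vectorField le_rfl hτ0
  have h1 : δ ≤ ∫ s in (0 : ℝ)..τ, ‖P.f (X s) + mulEuc (P.g (X s)) (u s)‖ := by
    have h2 := hX.sub_eq_integral hP hu le_rfl hτ0
    rw [hX.zero_eq] at h2
    rw [← hτ, dist_eq_norm, h2]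
    exact intervalIntegral.norm_integral_le_integral_norm hτ0
  calc κ * δ ≤ κ * ∫ s in (0 : ℝ)..τ, ‖P.f (X s) + mulEuc (P.g (X s)) (u s)‖ := by gcongr
    _ = ∫ s in (0 : ℝ)..τ, κ * ‖P.f (X s) + mulEuc (P.g (X s)) (u s)‖ :=
        (intervalIntegral.integral_const_mul _ _).symm
    _ ≤ _ := intervalIntegral.integral_mono_on hτ0 (hF.norm.const_mul κ)
        (hu.intervalIntegrable_comp hX.continuousOn hP.continuous_runningCost le_rfl hτ0)
        fun s hs => hκK _ (hin s hs) _

/-- A trajectory from inside a ball whose cost is below the optimal values on the bounding sphere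
stays in the ball. -/
theorem IsTrajectory.norm_le_of_cost_lt {u : ℝ → Euc M} {X : ℝ → Euc N}
    (hX : P.IsTrajectory x u X) (hP : P.Admissible) (hu : IsInput u) (hxr : ‖x‖ < r)
    (hr : ∀ y ∈ sphere (0 : Euc N) r, P.cost u X < P.optimalValue y) :
    ∀ t, 0 ≤ t → ‖X t‖ ≤ r := by
  intro t ht
  by_contra! hlt
  obtain ⟨τ, hτ0, hτ, -⟩ := exists_first_hitting_time (φ := fun t => ‖X t‖)
    hX.continuousOn.norm (by simpa [hX.zero_eq] using hxr) ht hlt.le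
  exact (hr (X τ) (mem_sphere_zero_iff_norm.2 hτ)).not_ge
    (hX.optimalValue_apply_le_cost hP hu hτ0)

/-- Near the origin, a solution of the Hamilton-Jacobi-Bellman equation bounded by `β ‖·‖²` is
dominated by the optimal value. -/
theorem SolvesHJB.le_optimalValue (hv : P.SolvesHJB v Ω) (hP : P.Admissible)
    (hΩ : IsOpen Ω) (hv1 : ContDiffOn ℝ 1 v Ω) (hβ : 0 < β)
    (hvβ : ∀ y ∈ Ω, v y ≤ β * ‖y‖ ^ 2) (hrΩ : closedBall 0 r ⊆ Ω) (hxr : ‖x‖ < r) {m : ℝ≥0∞}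
    (hm : ∀ y ∈ sphere (0 : Euc N) r, m ≤ P.optimalValue y) (hxm : P.optimalValue x < m) :
    ENNReal.ofReal (v x) ≤ P.optimalValue x := by
  refine le_of_forall_gt fun c hc => ?_
  -- Cost below `m` confines the trajectory to the ball; cost below `c` then yields the bound.
  have hlt : P.optimalValue x < min c m := lt_min hc hxm
  rw [optimalValue] at hlt
  simp only [iInf_lt_iff, objective] at hlt
  obtain ⟨u, hu, X, hX, hcost⟩ := hlt
  refine lt_of_le_of_lt (hv.le_cost hP hΩ hv1 hβ hvβ hrΩ hu hX ?_)
    (hcost.trans_le (min_le_left _ _))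
  exact hX.norm_le_of_cost_lt hP hu hxr fun y hy =>
    (hcost.trans_le (min_le_right _ _)).trans_le (hm y hy)

end ControlProblem

/-! ### The common neighborhood -/

theorem mainTheorem7 {N : ℕ} (Ω : Set (Euc N)) (hΩ_open : IsOpen Ω) (hΩ_conn : IsConnected Ω)
    (hΩ_zero : (0 : Euc N) ∈ Ω) (α β : ℝ) (hα : 0 < α) (hβ : 0 < β)
    (vstar : Euc N → ℝ≥0∞) (hvstar : ControlProblem.IsRealC1On vstar Ω) :
    ∃ Ω' : Set (Euc N), Ω' ⊆ Ω ∧ IsOpen Ω' ∧ (0 : Euc N) ∈ Ω' ∧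
      ∀ (M : ℕ) (P : ControlProblem N M), P.Admissible →
        (∀ x ∈ Ω, P.optimalValue x = vstar x) →
        ∀ v : Euc N → ℝ, ContDiffOn ℝ 1 v Ω →
          (∀ x ∈ Ω, 0 ≤ v x) → v 0 = 0 →
          P.SolvesHJB v Ω →
          (∀ x ∈ Ω, α * ‖x‖ ^ 2 ≤ v x ∧ v x ≤ β * ‖x‖ ^ 2) →
          ∀ x ∈ Ω', v x = (vstar x).toReal := by
  -- The neighborhood is chosen before the problem. Any one problem with value `vstar` shows that
  -- `vstar` vanishes at the origin and is positive elsewhere on `Ω`; without one, the claim is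
  -- vacuous.
  by_cases hex : ∃ (M : ℕ) (P : ControlProblem N M), P.Admissible ∧
      ∀ x ∈ Ω, P.optimalValue x = vstar x
  swap
  · exact ⟨Ω, Subset.rfl, hΩ_open, hΩ_zero, fun M P hP hPv => (hex ⟨M, P, hP, hPv⟩).elim⟩
  obtain ⟨r, hr, hrΩ⟩ := Metric.nhds_basis_closedBall.mem_iff.1 (hΩ_open.mem_nhds hΩ_zero)
  obtain ⟨hfin, hC1⟩ := hvstar
  have hcont : ContinuousOn (fun x => (vstar x).toReal) Ω := hC1.continuousOn
  have hzero : vstar 0 = 0 := by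
    obtain ⟨M, P, hP, hPv⟩ := hex
    rw [← hPv 0 hΩ_zero, hP.optimalValue_zero]
  have hpos : ∀ y ∈ Ω, y ≠ 0 → 0 < (vstar y).toReal := by
    obtain ⟨M, P, hP, hPv⟩ := hex
    intro y hy hy0
    refine ENNReal.toReal_pos ?_ (hfin y hy)
    rw [← hPv y hy]
    exact (hP.optimalValue_pos hy0).ne'
  have hsphΩ : Metric.sphere (0 : Euc N) r ⊆ Ω := Metric.sphere_subset_closedBall.trans hrΩ
  obtain ⟨m, hm0, hm⟩ : ∃ m : ℝ, 0 < m ∧ ∀ y ∈ Metric.sphere (0 : Euc N) r,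
      m ≤ (vstar y).toReal := by
    rcases (Metric.sphere (0 : Euc N) r).eq_empty_or_nonempty with he | hne
    · exact ⟨1, one_pos, fun y hy => by simp [he] at hy⟩
    · obtain ⟨z, hz, hmin⟩ := (isCompact_sphere (0 : Euc N) r).exists_isMinOn hne
        (hcont.mono hsphΩ)
      refine ⟨_, hpos z (hsphΩ hz) ?_, hmin⟩
      rintro rfl
      simp [hr.ne] at hz
  have hballΩ : Metric.ball (0 : Euc N) r ⊆ Ω := Metric.ball_subset_closedBall.trans hrΩ
  refine ⟨(Metric.ball 0 r ∩ (fun x => (vstar x).toReal) ⁻¹' Iio m)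
    ∩ {x | β * ‖x‖ ^ 2 < α * r ^ 2}, fun x hx => hballΩ hx.1.1, ?_, ?_, ?_⟩
  · refine IsOpen.inter ((hcont.mono hballΩ).isOpen_inter_preimage Metric.isOpen_ball isOpen_Iio)
      (isOpen_lt (by fun_prop) continuous_const)
  · have : 0 < α * r ^ 2 := by positivity
    exact ⟨⟨Metric.mem_ball_self hr, by simpa [hzero] using hm0⟩, by simpa using this⟩
  · rintro M P hP hPv v hv1 hv0 - hHJB hαβ x ⟨⟨hxr, hxm⟩, hxαβ⟩
    have hxΩ := hballΩ hxr
    rw [mem_ball_zero_iff] at hxr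
    have hle := hHJB.optimalValue_le hP hΩ_open hv1 hv0 hαβ hr hrΩ hxr hxαβ
    have hge := hHJB.le_optimalValue hP hΩ_open hv1 hβ (fun y hy => (hαβ y hy).2) hrΩ hxr
      (m := ENNReal.ofReal m) (fun y hy => by
        rw [hPv y (hsphΩ hy)]
        exact ENNReal.ofReal_le_of_le_toReal (hm y hy))
      (by rw [hPv x hxΩ]; exact (ENNReal.lt_ofReal_iff_toReal_lt (hfin x hxΩ)).2 hxm)
    rw [← hPv x hxΩ, le_antisymm hle hge, ENNReal.toReal_ofReal (hv0 x hxΩ)]
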